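/- There are absolute constants $C$ and $c$ such that the following holds. Let $n \ge 2$ be an integer and let $\epsilon > 1/(\log n)^{0.25}$ ($\log$ is the natural logarithm). Then there is a window length $\ell \le C\,\frac{\log n}{\epsilon}$, depending only on $n$ and $\epsilon$, such that for every alphabet size $d$, every Hidden Markov Model with at most $n$ hidden states and an output alphabet of size $d$ (arbitrary initial distribution, time-homogeneous transition probabilities, no mixing assumption), and every integer $T \ge d^{c\ell}$: let $x_0, x_1, \ldots, x_T$ be a single output sequence of the HMM, and let $t$ be chosen uniformly at random from $\{1, 2, \ldots, T\}$, independently of the sequence. Let $P_t$ be the conditional distribution of $x_t$ under the HMM given the entire history $x_0, \ldots, x_{t-1}$. Let $\hat P_t$ be the prediction of the empirical $\ell$-th order Markov model (the $(\ell+1)$-gram model) based on $x_0,\ldots,x_{t-1}$: $$\hat P_t(a) = \frac{\#\{s : 0 \le s < t-\ell,\ (x_s, \ldots, x_{s+\ell-1}) = (x_{t-\ell}, \ldots, x_{t-1}),\ x_{s+\ell} = a\}}{\#\{s : 0 \le s < t-\ell,\ (x_s, \ldots, x_{s+\ell-1}) = (x_{t-\ell}, \ldots, x_{t-1})\}},$$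 and, if the denominator is zero or $t<\ell$, $\hat P_t$ is an arbitrary probability distribution on the alphabet (which may depend on the history). Then $$\mathbb{E}\,\bigl\| P_t - \hat P_t \bigr\|_1 = \mathbb{E}\Bigl[\sum_a |P_t(a) - \hat P_t(a)|\Bigr] \le \sqrt{\epsilon},$$ where the expectation is over both $t$ and the output sequence. -/

import Mathlib

open scoped BigOperators

noncomputable section

/-- A (time-homogeneous) hidden Markov model with finite set `S` of hidden states and finite output
alphabet `A`: an arbitrary initial distribution, a stochastic transition matrix and a stochastic
emission matrix. No mixing, irreducibility or stationarity is assumed. -/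
structure HMM (S A : Type*) [Fintype S] [Fintype A] where
  init : S → ℝ
  trans : S → S → ℝ
  emit : S → A → ℝ
  init_mem : init ∈ stdSimplex ℝ S
  trans_mem : ∀ s, trans s ∈ stdSimplex ℝ S
  emit_mem : ∀ s, emit s ∈ stdSimplex ℝ A

namespace HMM

variable {S A : Type*} [Fintype S] [Fintype A]

/-- Probability that the first `m` hidden states are `h 0, …, h (m-1)` and the first `m` outputs
are `x 0, …, x (m-1)` (the output at time `i` is emitted by the hidden state at time `i`). -/
def jointProb (M : HMM S A) : (m : ℕ) → (Fin m → S) → (Fin m → A) → ℝ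
  | 0, _, _ => 1
  | m + 1, h, x =>
      M.init (h 0) * (∏ i : Fin m, M.trans (h i.castSucc) (h i.succ)) *
        ∏ i : Fin (m + 1), M.emit (h i) (x i)

/-- Probability that the first `m` outputs are `x 0, …, x (m-1)`. -/
def obsProb (M : HMM S A) {m : ℕ} (x : Fin m → A) : ℝ :=
  ∑ h : Fin m → S, M.jointProb m h x

/-- The true conditional distribution of the output at time `t` given the entire history
`x 0, …, x (t-1)`: `P(x_0, …, x_{t-1}, a) / P(x_0, …, x_{t-1})`.
(Histories of probability zero never contribute to the expectation below.) -/
def nextProb (M : HMM S A) {t : ℕ} (x : Fin t → A) (a : A) : ℝ :=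
  M.obsProb (Fin.snoc x a : Fin (t + 1) → A) / M.obsProb x

/-- Expected `ℓ₁` distance at time `t` between the true conditional distribution of the output
given the history and the prediction `q` computed from the history. -/
def expectedL1 (M : HMM S A) (t : ℕ) (q : (Fin t → A) → A → ℝ) : ℝ :=
  ∑ x : Fin t → A, M.obsProb x * ∑ a : A, |M.nextProb x a - q x a|

end HMM

/-- Number of times that, within `x 0, …, x (t-1)`, the length-`l` string `x (t-l), …, x (t-1)`
(the most recent `l` observations) occurs immediately followed by the letter `a`;
`s` is the starting position of the occurrence. It is `0` when `t ≤ l`. -/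
def followCount {A : Type*} [DecidableEq A] (l : ℕ) {t : ℕ} (x : Fin t → A) (a : A) : ℕ :=
  (Finset.univ.filter fun s : Fin (t - l) =>
    (∀ j : Fin l, x ⟨s + j, by omega⟩ = x ⟨t - l + j, by have := s.isLt; omega⟩) ∧
      x ⟨s + l, by omega⟩ = a).card

/-- The naive empirical `l`-th order Markov model (the `(l+1)`-gram model): predict according to the
empirical frequencies of the letters that have followed the current length-`l` context in the
history `x`. If the context has never been followed by a letter (or there are fewer than `l`
observations), the frequencies are undefined and the model outputs `fallback`. -/
def empiricalMarkov {A : Type*} [Fintype A] [DecidableEq A] (l : ℕ) {t : ℕ}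
    (fallback : A → ℝ) (x : Fin t → A) (a : A) : ℝ :=
  if ∑ b : A, followCount l x b = 0 then fallback a
  else (followCount l x a : ℝ) / ((∑ b : A, followCount l x b : ℕ) : ℝ)

end

/-! The argument bounds cumulative log loss along every output sequence of positive probability, so
neither stationarity nor mixing enters. The add-one (Laplace) estimator, run separately in each
length-`l` context, has small regret against every fixed kernel that reads only the context
(`laplace_regret`). The HMM supplies `l + 1` such kernels: for `j ≤ l`, predict the next letter from
the last `j` letters, starting from a uniform hidden state.

No single kernel need be good, but their average is. For a fixed starting position, the
log-likelihoods for `j = 0, …, l` telescope to that of a block of `l + 1` letters. A uniform prior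
dominates the true hidden-state law up to the factor `card S`, so the block costs at most `log (card
S)` more than under the true model. Summing over starting positions counts each letter about `l + 1`
times. Hence the average kernel, and so the Laplace estimator, loses to the truth only `log (card S)
/ (l + 1)` per step, plus the cost of learning the frequencies (`HMM.mul_log_obsProb_le`,
`HMM.sum_log_laplace_le`).

In expectation the log-loss excess is a sum of relative entropies. A linearised Pinsker inequality
turns it into `ℓ₁` error, and removing the smoothing costs no more than a multiple of the learning
cost (`HMM.sum_expectedL1_empiricalMarkov_le`). With `l` of order `log n / ε` and `T ≥ d ^ (6 * l)`,
the average error is at most `√ε`. -/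

theorem List.ofFn_snoc {A : Type*} {m : ℕ} (x : Fin m → A) (a : A) :
    List.ofFn (Fin.snoc x a : Fin (m + 1) → A) = List.ofFn x ++ [a] := by
  rw [List.ofFn_succ']
  simp

/-! ### Word likelihoods and output probabilities -/

namespace HMM

variable {S A : Type*} [Fintype S] [Fintype A]

/-- The probability that an HMM whose current hidden state is `s` emits the word `w`. -/
noncomputable def lik (M : HMM S A) : List A → S → ℝ
  | [], _ => 1
  | a :: w, s => M.emit s a * ∑ s', M.trans s s' * M.lik w s'

/-- The sum of the likelihoods of a word over all starting hidden states. -/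
noncomputable def totalLik (M : HMM S A) (w : List A) : ℝ := ∑ s, M.lik w s

/-- The HMM with the same dynamics, whose initial hidden state is a successor of `s`. -/
def startAfter (M : HMM S A) (s : S) : HMM S A :=
  { M with init := M.trans s, init_mem := M.trans_mem s }

theorem lik_startAfter (M : HMM S A) (s₀ : S) (w : List A) (s : S) :
    (M.startAfter s₀).lik w s = M.lik w s := by
  induction w generalizing s with
  | nil => rfl
  | cons a w ih => simp only [lik, ih]; rfl

theorem lik_nonneg (M : HMM S A) (w : List A) (s : S) : 0 ≤ M.lik w s := by
  induction w generalizing s with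
  | nil => exact zero_le_one
  | cons a w ih =>
    exact mul_nonneg ((M.emit_mem s).1 a)
      (Finset.sum_nonneg fun s' _ => mul_nonneg ((M.trans_mem s).1 s') (ih s'))

theorem totalLik_nonneg (M : HMM S A) (w : List A) : 0 ≤ M.totalLik w :=
  Finset.sum_nonneg fun s _ => M.lik_nonneg w s

theorem sum_lik_concat (M : HMM S A) (w : List A) (s : S) :
    ∑ a, M.lik (w ++ [a]) s = M.lik w s := by
  induction w generalizing s with
  | nil => simp [lik, (M.trans_mem s).2, (M.emit_mem s).2]
  | cons b w ih =>
    simp only [List.cons_append, lik, ← Finset.mul_sum]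
    rw [Finset.sum_comm]
    simp only [← Finset.mul_sum, ih]

theorem sum_totalLik_concat (M : HMM S A) (w : List A) :
    ∑ a, M.totalLik (w ++ [a]) = M.totalLik w := by
  unfold totalLik
  rw [Finset.sum_comm]
  simp only [sum_lik_concat]

/-- Whatever hidden state is reached after `v`, its likelihood of `w` is one term of `totalLik w`.
This is the only place where information about the past is discarded; since `totalLik` is `card S`
times the likelihood under a uniform start, the price is a factor `card S`. -/
theorem lik_append_le (M : HMM S A) (v w : List A) (s : S) :
    M.lik (v ++ w) s ≤ M.lik v s * M.totalLik w := by
  induction v generalizing s with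
  | nil =>
    simpa [lik, totalLik] using
      Finset.single_le_sum (fun s _ => M.lik_nonneg w s) (Finset.mem_univ s)
  | cons a v ih =>
    simp only [List.cons_append, lik, mul_assoc, Finset.sum_mul]
    exact mul_le_mul_of_nonneg_left
      (Finset.sum_le_sum fun s' _ => mul_le_mul_of_nonneg_left (ih s') ((M.trans_mem s).1 s'))
      ((M.emit_mem s).1 a)

theorem jointProb_cons (M : HMM S A) (m : ℕ) (s : S) (h : Fin m → S) (x : Fin (m + 1) → A) :
    M.jointProb (m + 1) (Fin.cons s h : Fin (m + 1) → S) x =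
      M.init s * (M.emit s (x 0) * (M.startAfter s).jointProb m h (fun i => x i.succ)) := by
  cases m with
  | zero => simp [jointProb]
  | succ m =>
    simp only [jointProb, startAfter]
    rw [Fin.prod_univ_succ, Fin.prod_univ_succ (n := m + 1)]
    simp only [Fin.castSucc_zero, Fin.cons_zero, Fin.cons_succ, Fin.castSucc_succ]
    ring

theorem obsProb_eq_sum_lik (M : HMM S A) {m : ℕ} (x : Fin m → A) :
    M.obsProb x = ∑ s, M.init s * M.lik (List.ofFn x) s := by
  induction m generalizing M with
  | zero => simp [obsProb, jointProb, lik, M.init_mem.2]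
  | succ m ih =>
    unfold obsProb
    rw [← (Fin.consEquiv fun _ => S).sum_comp, Fintype.sum_prod_type]
    refine Finset.sum_congr rfl fun s _ => ?_
    simp only [Fin.consEquiv, Equiv.coe_fn_mk, jointProb_cons, List.ofFn_succ, lik,
      ← Finset.mul_sum]
    have h := ih (M.startAfter s) (fun i => x i.succ)
    simp only [lik_startAfter] at h
    rw [← show (M.startAfter s).init = M.trans s from rfl, ← h]
    rfl

theorem obsProb_nonneg (M : HMM S A) {m : ℕ} (x : Fin m → A) : 0 ≤ M.obsProb x := by
  rw [obsProb_eq_sum_lik]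
  exact Finset.sum_nonneg fun s _ => mul_nonneg (M.init_mem.1 s) (M.lik_nonneg _ s)

theorem sum_obsProb_snoc (M : HMM S A) {m : ℕ} (x : Fin m → A) :
    ∑ a, M.obsProb (Fin.snoc x a : Fin (m + 1) → A) = M.obsProb x := by
  simp only [obsProb_eq_sum_lik, List.ofFn_snoc]
  rw [Finset.sum_comm]
  simp only [← Finset.mul_sum, sum_lik_concat]

theorem obsProb_snoc_le (M : HMM S A) {m : ℕ} (x : Fin m → A) (a : A) :
    M.obsProb (Fin.snoc x a : Fin (m + 1) → A) ≤ M.obsProb x := by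
  rw [← sum_obsProb_snoc M x]
  exact Finset.single_le_sum
    (f := fun a => M.obsProb (Fin.snoc x a : Fin (m + 1) → A))
    (fun a _ => M.obsProb_nonneg _) (Finset.mem_univ a)

theorem obsProb_mul_nextProb (M : HMM S A) {m : ℕ} (x : Fin m → A) (a : A) :
    M.obsProb x * M.nextProb x a = M.obsProb (Fin.snoc x a : Fin (m + 1) → A) := by
  -- On a null history the quotient is the junk value `0`, but every extension is null too, so both
  -- sides vanish.
  rcases (M.obsProb_nonneg x).eq_or_lt with h | h
  · have h1 := M.obsProb_snoc_le x a
    have h2 := M.obsProb_nonneg (Fin.snoc x a : Fin (m + 1) → A)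
    rw [← h] at h1 ⊢
    linarith
  · rw [nextProb, mul_div_cancel₀ _ h.ne']

theorem nextProb_mem (M : HMM S A) {m : ℕ} (x : Fin m → A) (h : 0 < M.obsProb x) :
    M.nextProb x ∈ stdSimplex ℝ A := by
  refine ⟨fun a => div_nonneg (M.obsProb_nonneg _) (M.obsProb_nonneg _), ?_⟩
  simp only [nextProb]
  rw [← Finset.sum_div, sum_obsProb_snoc, div_self h.ne']

theorem sum_obsProb (M : HMM S A) (m : ℕ) : ∑ x : Fin m → A, M.obsProb x = 1 := by
  induction m with
  | zero => simp [obsProb, jointProb]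
  | succ m ih =>
    rw [← (Fin.snocEquiv fun _ => A).sum_comp, Fintype.sum_prod_type_right]
    simp only [Fin.snocEquiv, Equiv.coe_fn_mk]
    rw [← ih]
    exact Finset.sum_congr rfl fun x _ => M.sum_obsProb_snoc x

/-- Summing a one-step cost over time in expectation is the same as taking the expectation of the
sum of the costs along the whole output sequence. -/
theorem sum_obsProb_mul_sum_nextProb (M : HMM S A) (g : (t : ℕ) → (Fin t → A) → A → ℝ) (L : ℕ) :
    ∑ t ∈ Finset.range L, ∑ x : Fin t → A, M.obsProb x * ∑ a, M.nextProb x a * g t x a =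
      ∑ x : Fin L → A, M.obsProb x *
        ∑ t : Fin L, g t (fun i : Fin t => x ⟨i, i.isLt.trans t.isLt⟩) (x t) := by
  induction L with
  | zero => simp
  | succ L ih =>
    rw [Finset.sum_range_succ, ih, ← Finset.sum_add_distrib,
      ← (Fin.snocEquiv fun _ => A).sum_comp, Fintype.sum_prod_type_right]
    refine Finset.sum_congr rfl fun x _ => ?_
    simp only [Fin.snocEquiv, Equiv.coe_fn_mk]
    have key : ∀ a : A, ∑ t : Fin (L + 1), g t
        (fun i : Fin t => (Fin.snoc x a : Fin (L + 1) → A) ⟨i, i.isLt.trans t.isLt⟩)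
        ((Fin.snoc x a : Fin (L + 1) → A) t) =
        ∑ t : Fin L, g t (fun i : Fin t => x ⟨i, i.isLt.trans t.isLt⟩) (x t) + g L x a := by
      intro a
      rw [Fin.sum_univ_castSucc]
      congr 1
      · refine Finset.sum_congr rfl fun t _ => ?_
        rw [Fin.snoc_castSucc]
        congr 1
        funext i
        exact Fin.snoc_castSucc (α := fun _ => A) a x ⟨i, i.isLt.trans t.isLt⟩
      · rw [Fin.snoc_last]
        congr 1
        funext i
        exact Fin.snoc_castSucc (α := fun _ => A) a x i
    simp only [key, mul_add, Finset.sum_add_distrib, ← Finset.sum_mul]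
    rw [sum_obsProb_snoc]
    congr 1
    rw [Finset.mul_sum]
    refine Finset.sum_congr rfl fun a _ => ?_
    rw [← mul_assoc, obsProb_mul_nextProb]

end HMM

/-! ### Counting visits along a sequence -/

/-- The number of occurrences of `w` among the first `i` terms of the sequence `z`. -/
def occ {W : Type*} [DecidableEq W] (z : ℕ → W) (i : ℕ) (w : W) : ℕ :=
  ∑ s ∈ Finset.range i, if z s = w then 1 else 0

section Occ

variable {W : Type*} [DecidableEq W]

theorem occ_succ (z : ℕ → W) (i : ℕ) (w : W) :
    occ z (i + 1) w = occ z i w + if z i = w then 1 else 0 := Finset.sum_range_succ _ _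

theorem occ_le (z : ℕ → W) (i : ℕ) (w : W) : occ z i w ≤ i := by
  rw [occ, ← Finset.card_filter]
  exact (Finset.card_filter_le _ _).trans (Finset.card_range i).le

/-- Group the times by the symbol seen: successive visits to `w` find the earlier-visit counts `0,
1, 2, …`. -/
theorem sum_occ [Fintype W] (z : ℕ → W) (φ : ℕ → ℝ) (N : ℕ) :
    ∑ i ∈ Finset.range N, φ (occ z i (z i)) = ∑ w, ∑ j ∈ Finset.range (occ z N w), φ j := by
  induction N with
  | zero => simp [occ]
  | succ N ih =>
    rw [Finset.sum_range_succ, ih]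
    have h : ∀ w, ∑ j ∈ Finset.range (occ z (N + 1) w), φ j =
        ∑ j ∈ Finset.range (occ z N w), φ j + if z N = w then φ (occ z N w) else 0 := by
      intro w
      rw [occ_succ]
      split_ifs
      · rw [Finset.sum_range_succ]
      · simp
    simp [h, Finset.sum_add_distrib]

theorem sum_range_eq_sum_occ_mul [Fintype W] (z : ℕ → W) (φ : W → ℝ) (N : ℕ) :
    ∑ i ∈ Finset.range N, φ (z i) = ∑ w, (occ z N w : ℝ) * φ w := by
  induction N with
  | zero => simp [occ]
  | succ N ih => simp [Finset.sum_range_succ, ih, occ_succ, add_mul, Finset.sum_add_distrib]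

theorem sum_occ_pair {A : Type*} [Fintype A] [DecidableEq A] (u : ℕ → W) (y : ℕ → A) (i : ℕ)
    (w : W) : ∑ a, occ (fun s => (u s, y s)) i (w, a) = occ u i w := by
  induction i with
  | zero => simp [occ]
  | succ i ih =>
    simp only [occ_succ, Finset.sum_add_distrib, ih, Prod.mk.injEq]
    congr 1
    by_cases h : u i = w <;> simp [h]

/-- Each symbol contributes a partial harmonic sum. -/
theorem sum_inv_occ_le [Fintype W] (z : ℕ → W) (N : ℕ) :
    ∑ i ∈ Finset.range N, 1 / ((occ z i (z i) : ℝ) + 1) ≤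
      Fintype.card W * (1 + Real.log N) := by
  rw [sum_occ z (fun j => 1 / ((j : ℝ) + 1)) N]
  refine (Finset.sum_le_card_nsmul _ _ (1 + Real.log N) fun w _ => ?_).trans
    (by rw [Finset.card_univ, nsmul_eq_mul])
  calc ∑ j ∈ Finset.range (occ z N w), 1 / ((j : ℝ) + 1)
      ≤ ∑ j ∈ Finset.range N, 1 / ((j : ℝ) + 1) :=
        Finset.sum_le_sum_of_subset_of_nonneg (Finset.range_mono (occ_le z N w))
          fun j _ _ => by positivity
    _ = (harmonic N : ℝ) := by simp [harmonic]
    _ ≤ 1 + Real.log N := harmonic_le_one_add_log N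

end Occ

/-! ### Regret of the Laplace estimator -/

/-- Cost of one step of the Laplace estimator compared with the growth of the empirical entropy. -/
theorem log_laplace_le (m N : ℕ) (d : ℝ) (hd : 1 ≤ d) :
    Real.log ((N + d) / (m + 1)) ≤
      ((N + 1 : ℕ) * Real.log (N + 1 : ℕ) - N * Real.log N) -
        ((m + 1 : ℕ) * Real.log (m + 1 : ℕ) - m * Real.log m) + d / (N + 1) := by
  have hN : (0 : ℝ) < N + 1 := by positivity
  have hm : (0 : ℝ) < m + 1 := by positivity
  -- With `f k = k * log k`, the increment of `f` at `m` is at most `log (m + 1) + 1`, and at `N` it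
  -- is at least `log (N + 1) + 1 - 1 / (N + 1)`. The ones cancel, and `h3` absorbs the remaining `1
  -- / (N + 1)`.
  have h1 : (m : ℝ) * (Real.log (m + 1) - Real.log m) ≤ 1 := by
    rcases Nat.eq_zero_or_pos m with rfl | h
    · simp
    · have h' : (0 : ℝ) < m := by exact_mod_cast h
      rw [← Real.log_div hm.ne' h'.ne']
      have := Real.log_le_sub_one_of_pos (show (0 : ℝ) < (m + 1) / m by positivity)
      calc (m : ℝ) * Real.log ((m + 1) / m) ≤ m * ((m + 1) / m - 1) := by gcongr
        _ = 1 := by field_simp; ring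
  have h2 : 1 - 1 / (N + 1 : ℝ) ≤ N * (Real.log (N + 1) - Real.log N) := by
    rcases Nat.eq_zero_or_pos N with rfl | h
    · simp
    · have h' : (0 : ℝ) < N := by exact_mod_cast h
      have := Real.log_le_sub_one_of_pos (show (0 : ℝ) < N / (N + 1) by positivity)
      rw [Real.log_div h'.ne' hN.ne'] at this
      calc 1 - 1 / (N + 1 : ℝ) = N * (1 - N / (N + 1)) := by field_simp; ring
        _ ≤ N * (Real.log (N + 1) - Real.log N) := by
          apply mul_le_mul_of_nonneg_left _ h'.le; linarith
  have h3 : Real.log (N + d) - Real.log (N + 1) ≤ d / (N + 1) - 1 / (N + 1) := by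
    rw [← Real.log_div (by positivity) hN.ne']
    refine (Real.log_le_sub_one_of_pos (by positivity)).trans (le_of_eq ?_)
    field_simp; ring
  rw [Real.log_div (by positivity) hm.ne']
  push_cast
  linarith

/-- Gibbs' inequality for unnormalised counts. -/
theorem count_entropy_le {A : Type*} [Fintype A] (n : A → ℕ) (q : A → ℝ) (hq : ∀ a, 0 ≤ q a)
    (hq1 : ∑ a, q a ≤ 1) (hpos : ∀ a, n a ≠ 0 → 0 < q a) :
    ((∑ a, n a : ℕ) : ℝ) * Real.log (∑ a, n a : ℕ) - ∑ a, (n a : ℝ) * Real.log (n a) ≤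
      ∑ a, (n a : ℝ) * (-Real.log (q a)) := by
  set N : ℕ := ∑ a, n a with hN
  have hle : ∀ a, (n a : ℝ) * (Real.log N - Real.log (n a) + Real.log (q a)) ≤
      N * q a - n a := by
    intro a
    rcases Nat.eq_zero_or_pos (n a) with h | h
    · simp only [h, Nat.cast_zero, zero_mul, sub_zero]
      exact mul_nonneg (Nat.cast_nonneg _) (hq a)
    · have h' : (0 : ℝ) < n a := by exact_mod_cast h
      have hN' : (0 : ℝ) < N := lt_of_lt_of_le h' (by
        exact_mod_cast Finset.single_le_sum (fun _ _ => Nat.zero_le _) (Finset.mem_univ a))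
      have hqa := hpos a h.ne'
      have := Real.log_le_sub_one_of_pos (show (0 : ℝ) < N * q a / n a by positivity)
      rw [Real.log_div (by positivity) h'.ne', Real.log_mul hN'.ne' hqa.ne'] at this
      calc _ ≤ (n a : ℝ) * (N * q a / n a - 1) := by
            apply mul_le_mul_of_nonneg_left _ h'.le; linarith
        _ = _ := by field_simp
  have hsum := Finset.sum_le_sum fun a (_ : a ∈ Finset.univ) => hle a
  rw [Finset.sum_sub_distrib, ← Finset.mul_sum, ← Nat.cast_sum, ← hN] at hsum
  simp only [mul_add, mul_sub, Finset.sum_add_distrib, Finset.sum_sub_distrib,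
    ← Finset.sum_mul] at hsum
  rw [← Nat.cast_sum, ← hN] at hsum
  simp only [mul_neg, Finset.sum_neg_distrib]
  have : (N : ℝ) * ∑ a, q a ≤ N := mul_le_of_le_one_right (Nat.cast_nonneg _) hq1
  linarith

/-- The log loss of the Laplace estimator, run separately in every context, exceeds that of any
fixed kernel `q` by at most `∑ d / (N + 1)`, where `N` counts earlier visits to the context. -/
theorem laplace_regret {W A : Type*} [Fintype W] [DecidableEq W] [Fintype A] [DecidableEq A]
    [Nonempty A] (u : ℕ → W) (y : ℕ → A) (N : ℕ) (q : W → A → ℝ) (hq : ∀ w a, 0 ≤ q w a)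
    (hq1 : ∀ w, ∑ a, q w a ≤ 1) (hpos : ∀ i < N, 0 < q (u i) (y i)) :
    ∑ i ∈ Finset.range N, Real.log ((occ u i (u i) + Fintype.card A) /
        (occ (fun s => (u s, y s)) i (u i, y i) + 1)) ≤
      ∑ i ∈ Finset.range N, (-Real.log (q (u i) (y i))) +
        ∑ i ∈ Finset.range N, (Fintype.card A : ℝ) / (occ u i (u i) + 1) := by
  set z : ℕ → W × A := fun s => (u s, y s) with hz
  have hcard : (1 : ℝ) ≤ Fintype.card A := by exact_mod_cast Fintype.card_pos
  let f : ℕ → ℝ := fun k => (k : ℝ) * Real.log k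
  have h1 : ∀ i, Real.log ((occ u i (u i) + Fintype.card A) / (occ z i (z i) + 1)) ≤
      (f (occ u i (u i) + 1) - f (occ u i (u i))) - (f (occ z i (z i) + 1) - f (occ z i (z i))) +
        (Fintype.card A : ℝ) / (occ u i (u i) + 1) := fun i => log_laplace_le _ _ _ hcard
  have h2 := Finset.sum_le_sum fun i (_ : i ∈ Finset.range N) => h1 i
  rw [Finset.sum_add_distrib, Finset.sum_sub_distrib,
    sum_occ u (fun k => f (k + 1) - f k), sum_occ z (fun k => f (k + 1) - f k)] at h2
  -- Within each context, and within each context-letter pair, the increments of `f` telescope,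
  -- leaving the empirical conditional entropy, which Gibbs' inequality compares with `q`.
  simp only [Finset.sum_range_sub] at h2
  have hf0 : f 0 = 0 := by simp [f]
  simp only [hf0, sub_zero, Fintype.sum_prod_type] at h2
  rw [← Finset.sum_sub_distrib] at h2
  refine h2.trans (add_le_add_left ?_ _)
  rw [show ∑ i ∈ Finset.range N, -Real.log (q (u i) (y i)) = _ from
    sum_range_eq_sum_occ_mul z (fun p => -Real.log (q p.1 p.2)) N, Fintype.sum_prod_type]
  refine Finset.sum_le_sum fun w _ => ?_
  have := count_entropy_le (fun a => occ z N (w, a)) (q w) (hq w) (hq1 w) (by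
    intro a ha
    rw [occ, ← Finset.card_filter, ← Nat.pos_iff_ne_zero, Finset.card_pos] at ha
    obtain ⟨i, hi⟩ := ha
    simp only [Finset.mem_filter, Finset.mem_range, hz, Prod.mk.injEq] at hi
    obtain ⟨hi, rfl, rfl⟩ := hi
    exact hpos i hi)
  rwa [sum_occ_pair u y N w] at this

/-! ### Block likelihoods and the averaging over context lengths -/

/-- The `j` consecutive terms of the sequence `X` that start at position `s`. -/
def subword {A : Type*} (X : ℕ → A) (s j : ℕ) : List A := (List.range' s j).map X

section Subword

variable {A : Type*} (X : ℕ → A)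

theorem subword_add (s i j : ℕ) :
    subword X s (i + j) = subword X s i ++ subword X (s + i) j := by
  simp [subword, ← List.map_append, List.range'_append_1]

theorem subword_succ (s j : ℕ) : subword X s (j + 1) = subword X s j ++ [X (s + j)] := by
  rw [subword_add]; rfl

theorem ofFn_eq_subword (s j : ℕ) : List.ofFn (fun i : Fin j => X (s + i)) = subword X s j :=
  List.ext_getElem (by simp [subword]) fun i _ _ => by simp [subword]

theorem drop_subword (s i j : ℕ) : (subword X s (i + j)).drop i = subword X (s + i) j := by
  rw [subword_add, List.drop_left' (by simp [subword])]

theorem ofFn_prefix (t : ℕ) : List.ofFn (fun i : Fin t => X i) = subword X 0 t := by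
  simpa using ofFn_eq_subword X 0 t

theorem prefix_succ (t : ℕ) :
    (fun i : Fin (t + 1) => X i) = Fin.snoc (α := fun _ => A) (fun i : Fin t => X i) (X t) := by
  funext i
  refine Fin.lastCases ?_ (fun i => ?_) i
  · simp
  · rw [Fin.snoc_castSucc]; rfl

end Subword

namespace HMM

variable {S A : Type*} [Fintype S] [Fintype A] (M : HMM S A) (X : ℕ → A)

theorem obsProb_prefix_add_le (s j : ℕ) :
    M.obsProb (fun i : Fin (s + j) => X i) ≤
      M.obsProb (fun i : Fin s => X i) * M.totalLik (subword X s j) := by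
  rw [obsProb_eq_sum_lik, obsProb_eq_sum_lik, ofFn_prefix, ofFn_prefix, subword_add,
    Finset.sum_mul, zero_add]
  refine Finset.sum_le_sum fun h _ => ?_
  rw [mul_assoc]
  exact mul_le_mul_of_nonneg_left (M.lik_append_le _ _ h) (M.init_mem.1 h)

theorem obsProb_prefix_antitone {s t : ℕ} (h : s ≤ t) :
    M.obsProb (fun i : Fin t => X i) ≤ M.obsProb (fun i : Fin s => X i) := by
  induction t, h using Nat.le_induction with
  | base => exact le_rfl
  | succ t _ ih =>
    rw [prefix_succ]
    exact (M.obsProb_snoc_le _ _).trans ih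

theorem obsProb_prefix_zero : M.obsProb (fun i : Fin 0 => X i) = 1 := by
  simp [obsProb, jointProb]

theorem totalLik_subword_pos {L s j : ℕ} (hL : 0 < M.obsProb (fun i : Fin L => X i))
    (h : s + j ≤ L) : 0 < M.totalLik (subword X s j) := by
  have h1 := hL.trans_le (M.obsProb_prefix_antitone X h)
  have h2 := h1.trans_le (M.obsProb_prefix_add_le X s j)
  exact pos_of_mul_pos_right h2 (M.obsProb_nonneg _)

theorem sum_log_nextProb {L : ℕ} (hL : 0 < M.obsProb (fun i : Fin L => X i)) :
    ∑ t ∈ Finset.range L, Real.log (M.nextProb (fun i : Fin t => X i) (X t)) =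
      Real.log (M.obsProb (fun i : Fin L => X i)) := by
  rw [← sub_zero (Real.log (M.obsProb (fun i : Fin L => X i))), ← Real.log_one,
    ← M.obsProb_prefix_zero X,
    ← Finset.sum_range_sub (fun t => Real.log (M.obsProb (fun i : Fin t => X i)))]
  refine Finset.sum_congr rfl fun t ht => ?_
  have ht := Finset.mem_range.1 ht
  have h1 := hL.trans_le (M.obsProb_prefix_antitone X ht.le)
  have h2 := hL.trans_le (M.obsProb_prefix_antitone X (Nat.succ_le_of_lt ht))
  rw [nextProb, ← prefix_succ, Real.log_div h2.ne' h1.ne']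

/-- The log-likelihood of the letter following a subword, given the subword, when the hidden state
before the subword is uniform. -/
noncomputable def logStep (s j : ℕ) : ℝ :=
  Real.log (M.totalLik (subword X s (j + 1))) - Real.log (M.totalLik (subword X s j))

theorem totalLik_concat_le (w : List A) (a : A) : M.totalLik (w ++ [a]) ≤ M.totalLik w := by
  rw [← M.sum_totalLik_concat w]
  exact Finset.single_le_sum (f := fun a => M.totalLik (w ++ [a]))
    (fun a _ => M.totalLik_nonneg _) (Finset.mem_univ a)

theorem logStep_nonpos {L s j : ℕ} (hL : 0 < M.obsProb (fun i : Fin L => X i))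
    (h : s + j < L) : M.logStep X s j ≤ 0 := by
  refine sub_nonpos.2 (Real.log_le_log (M.totalLik_subword_pos X hL (by omega)) ?_)
  rw [subword_succ]
  exact M.totalLik_concat_le _ _

theorem log_obsProb_prefix_add_le {L s j : ℕ} (hL : 0 < M.obsProb (fun i : Fin L => X i))
    (h : s + j ≤ L) :
    Real.log (M.obsProb (fun i : Fin (s + j) => X i)) -
        Real.log (M.obsProb (fun i : Fin s => X i)) - Real.log (Fintype.card S) ≤
      ∑ i ∈ Finset.range j, M.logStep X s i := by
  have h1 := hL.trans_le (M.obsProb_prefix_antitone X h)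
  have h2 := hL.trans_le (M.obsProb_prefix_antitone X ((Nat.le_add_right s j).trans h))
  have h3 := M.totalLik_subword_pos X hL h
  have h4 := Real.log_le_log h1 (M.obsProb_prefix_add_le X s j)
  rw [Real.log_mul h2.ne' h3.ne'] at h4
  have h5 : M.totalLik (subword X s 0) = Fintype.card S := by simp [totalLik, subword, lik]
  simp only [logStep]
  rw [Finset.sum_range_sub (fun i => Real.log (M.totalLik (subword X s i))), h5]
  linarith

/-- The log-likelihood of a sequence is controlled by the log-likelihoods of its letters given
short segments before them, up to `log (card S)` per position, for `l + 1` subword lengths. -/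
theorem mul_log_obsProb_le (l N : ℕ) (hL : 0 < M.obsProb (fun i : Fin (N + l) => X i)) :
    (l + 1 : ℕ) * Real.log (M.obsProb (fun i : Fin (N + l) => X i)) -
        (N + l : ℕ) * Real.log (Fintype.card S) ≤
      ∑ j ∈ Finset.range (l + 1), ∑ i ∈ Finset.range N, M.logStep X (l - j + i) j := by
  set L := N + l with hLdef
  -- Freezing the prefix at length `L` lets blocks that overrun the end be treated as truncated
  -- blocks.
  let p : ℕ → ℝ := fun t => Real.log (M.obsProb (fun i : Fin (min t L) => X i))
  have hp_nonpos : ∀ t, p t ≤ 0 := fun t =>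
    Real.log_nonpos (M.obsProb_nonneg _)
      ((M.obsProb_prefix_antitone X (Nat.zero_le _)).trans (M.obsProb_prefix_zero X).le)
  -- The differences at distance `l + 1` telescope to `l + 1` copies of `p L` minus the first `l +
  -- 1` values of `p`, which are nonpositive.
  have h1 : ((l + 1 : ℕ) : ℝ) * p L ≤ ∑ s ∈ Finset.range L, (p (s + (l + 1)) - p s) := by
    have e1 := Finset.sum_range_add p L (l + 1)
    have e2 := Finset.sum_range_add p (l + 1) L
    rw [add_comm (l + 1) L, e1] at e2
    have e3 : ∑ x ∈ Finset.range (l + 1), p (L + x) = (l + 1 : ℕ) * p L := by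
      rw [Finset.sum_congr rfl (g := fun _ => p L) fun x _ => by
        simp only [p]; rw [show min (L + x) L = min L L by simp]]
      simp
    have e4 : ∑ x ∈ Finset.range (l + 1), p x ≤ 0 := Finset.sum_nonpos fun x _ => hp_nonpos x
    rw [Finset.sum_sub_distrib]
    simp only [add_comm _ (l + 1)] at e2 ⊢
    linarith
  have h2 : ∑ s ∈ Finset.range L, (p (s + (l + 1)) - p s) - L * Real.log (Fintype.card S) ≤
      ∑ s ∈ Finset.range L, ∑ j ∈ Finset.range (min (l + 1) (L - s)), M.logStep X s j := by
    rw [show (L : ℝ) * Real.log (Fintype.card S) =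
      ∑ s ∈ Finset.range L, Real.log (Fintype.card S) by simp, ← Finset.sum_sub_distrib]
    refine Finset.sum_le_sum fun s hs => ?_
    have hs := Finset.mem_range.1 hs
    have := M.log_obsProb_prefix_add_le X (s := s) (j := min (l + 1) (L - s)) hL (by omega)
    simp only [p]
    rwa [show min (s + (l + 1)) L = s + min (l + 1) (L - s) by omega, min_eq_left hs.le]
  have h3 : ∑ s ∈ Finset.range L, ∑ j ∈ Finset.range (min (l + 1) (L - s)), M.logStep X s j =
      ∑ j ∈ Finset.range (l + 1), ∑ s ∈ Finset.range (L - j), M.logStep X s j := by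
    refine Finset.sum_comm' fun s j => ?_
    simp only [Finset.mem_range]
    omega
  -- Dropping the first `l - j` nonpositive terms aligns all `j`: index `i` now always concerns the
  -- letter at position `l + i`.
  have h4 : ∀ j ∈ Finset.range (l + 1), ∑ s ∈ Finset.range (L - j), M.logStep X s j ≤
      ∑ i ∈ Finset.range N, M.logStep X (l - j + i) j := by
    intro j hj
    have hj := Finset.mem_range.1 hj
    rw [show L - j = l - j + N by omega, Finset.sum_range_add]
    refine add_le_of_nonpos_left (Finset.sum_nonpos fun s hs => ?_)
    have hs := Finset.mem_range.1 hs
    by_cases hN : s + j < L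
    · exact M.logStep_nonpos X hL hN
    · omega
  have h5 : p L = Real.log (M.obsProb (fun i : Fin L => X i)) := by
    simp only [p]
    rw [min_self]
  rw [← h5]
  linarith [Finset.sum_le_sum h4]

end HMM

/-! ### Pathwise log loss against the true model -/

/-- The length-`l` context of `X` that starts at position `s`. -/
def window {A : Type*} (X : ℕ → A) (l s : ℕ) : Fin l → A := fun j => X (s + j)

/-- Pathwise log-loss bound for the Laplace estimator run in every length-`l` context. -/
theorem HMM.sum_log_laplace_le {S A : Type*} [Fintype S] [Fintype A] [DecidableEq A]
    [Nonempty A] (M : HMM S A) (X : ℕ → A) (l N : ℕ)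
    (hL : 0 < M.obsProb (fun i : Fin (N + l) => X i)) :
    ∑ i ∈ Finset.range N, Real.log ((occ (window X l) i (window X l i) + Fintype.card A) /
        (occ (fun s => (window X l s, X (s + l))) i (window X l i, X (i + l)) + 1)) ≤
      (N + l : ℕ) * Real.log (Fintype.card S) / (l + 1) -
          Real.log (M.obsProb (fun i : Fin (N + l) => X i)) +
        ∑ i ∈ Finset.range N, (Fintype.card A : ℝ) / (occ (window X l) i (window X l i) + 1) := by
  set R := ∑ i ∈ Finset.range N, Real.log ((occ (window X l) i (window X l i) + Fintype.card A) /
    (occ (fun s => (window X l s, X (s + l))) i (window X l i, X (i + l)) + 1))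
  set D := ∑ i ∈ Finset.range N, (Fintype.card A : ℝ) / (occ (window X l) i (window X l i) + 1)
  -- Prediction from the last `j` letters of the context only, so each `q j` is a fixed kernel on
  -- length-`l` contexts.
  let q : ℕ → (Fin l → A) → A → ℝ := fun j w a =>
    M.totalLik ((List.ofFn w).drop (l - j) ++ [a]) / M.totalLik ((List.ofFn w).drop (l - j))
  have hdrop : ∀ j ≤ l, ∀ i,
      (List.ofFn (window X l i)).drop (l - j) = subword X (l - j + i) j := by
    intro j hj i
    have : List.ofFn (window X l i) = subword X i l := ofFn_eq_subword X i l
    rw [this, add_comm (l - j) i, ← drop_subword, Nat.sub_add_cancel hj]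
  have hstep : ∀ j ≤ l, ∀ i, q j (window X l i) (X (i + l)) =
      M.totalLik (subword X (l - j + i) (j + 1)) / M.totalLik (subword X (l - j + i) j) := by
    intro j hj i
    simp only [q, hdrop j hj i]
    rw [subword_succ, show l - j + i + j = i + l by omega]
  have hj : ∀ j ∈ Finset.range (l + 1),
      R ≤ -∑ i ∈ Finset.range N, M.logStep X (l - j + i) j + D := by
    intro j hj
    have hj : j ≤ l := Nat.lt_succ_iff.1 (Finset.mem_range.1 hj)
    have hpos : ∀ i < N, 0 < M.totalLik (subword X (l - j + i) (j + 1)) ∧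
        0 < M.totalLik (subword X (l - j + i) j) := fun i hi =>
      ⟨M.totalLik_subword_pos X hL (by omega), M.totalLik_subword_pos X hL (by omega)⟩
    have := laplace_regret (window X l) (fun s => X (s + l)) N (q j)
      (fun w a => div_nonneg (M.totalLik_nonneg _) (M.totalLik_nonneg _))
      (fun w => by
        simp only [q]
        rw [← Finset.sum_div, M.sum_totalLik_concat]
        -- A context of likelihood zero gives total mass `0`, which is why the regret bound asks
        -- only for subprobability kernels.
        exact div_self_le_one _)
      (fun i hi => by
        rw [hstep j hj i]
        exact div_pos (hpos i hi).1 (hpos i hi).2)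
    refine this.trans (le_of_eq ?_)
    rw [← Finset.sum_neg_distrib]
    congr 1
    refine Finset.sum_congr rfl fun i hi => ?_
    have hi := hpos i (Finset.mem_range.1 hi)
    rw [hstep j hj i, Real.log_div hi.1.ne' hi.2.ne', HMM.logStep]
  have hsum := Finset.sum_le_sum hj
  rw [Finset.sum_add_distrib, Finset.sum_neg_distrib] at hsum
  simp only [Finset.sum_const, Finset.card_range, nsmul_eq_mul] at hsum
  have hmain := M.mul_log_obsProb_le X l N hL
  have hl : (0 : ℝ) < (l + 1 : ℕ) := by positivity
  rw [← sub_le_iff_le_add, le_sub_iff_add_le, ← Nat.cast_succ, le_div_iff₀ hl]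
  nlinarith

theorem followCount_prefix {A : Type*} [DecidableEq A] (X : ℕ → A) (l t : ℕ) (a : A) :
    followCount l (fun i : Fin t => X i) a =
      occ (fun s => (window X l s, X (s + l))) (t - l) (window X l (t - l), a) := by
  rw [followCount, Finset.card_filter, occ,
    ← Fin.sum_univ_eq_sum_range (fun s => if (window X l s, X (s + l)) =
      (window X l (t - l), a) then 1 else 0)]
  simp only [Prod.mk.injEq, window, funext_iff]

theorem sum_followCount_prefix {A : Type*} [Fintype A] [DecidableEq A] (X : ℕ → A) (l t : ℕ) :
    ∑ a, followCount l (fun i : Fin t => X i) a =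
      occ (window X l) (t - l) (window X l (t - l)) := by
  simp only [followCount_prefix]
  exact sum_occ_pair _ _ _ _

/-- The Laplace (add-one) smoothing of the empirical `l`-th order Markov model. -/
noncomputable def laplaceMarkov {A : Type*} [Fintype A] [DecidableEq A] (l : ℕ) {t : ℕ}
    (x : Fin t → A) (a : A) : ℝ :=
  (followCount l x a + 1) / ((∑ b, followCount l x b : ℕ) + Fintype.card A)

theorem sum_inv_context_count_le {A : Type*} [Fintype A] [DecidableEq A]
    (X : ℕ → A) (l N : ℕ) :
    ∑ t ∈ Finset.range (N + l), (Fintype.card A : ℝ) /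
        ((∑ b, followCount l (fun i : Fin t => X i) b : ℕ) + 1) ≤
      Fintype.card A * (l + Fintype.card A ^ l * (1 + Real.log N)) := by
  simp only [sum_followCount_prefix]
  rw [add_comm N l, Finset.sum_range_add, mul_add]
  simp only [add_tsub_cancel_left]
  refine add_le_add ?_ ?_
  · rw [Finset.sum_congr rfl (g := fun _ => (Fintype.card A : ℝ)) fun t ht => ?_]
    · simp [mul_comm]
    · rw [Nat.sub_eq_zero_of_le (Finset.mem_range.1 ht).le]
      simp [occ]
  · have := sum_inv_occ_le (window X l) N
    simp only [Fintype.card_fun, Fintype.card_fin, Nat.cast_pow] at this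
    simp only [div_eq_mul_one_div (Fintype.card A : ℝ), ← Finset.mul_sum]
    exact mul_le_mul_of_nonneg_left this (Nat.cast_nonneg _)

theorem HMM.sum_log_nextProb_div_laplaceMarkov_le {S A : Type*} [Fintype S] [Fintype A]
    [DecidableEq A] [Nonempty A] (M : HMM S A) (X : ℕ → A) (l N : ℕ)
    (hL : 0 < M.obsProb (fun i : Fin (N + l) => X i)) :
    ∑ t ∈ Finset.range (N + l), Real.log (M.nextProb (fun i : Fin t => X i) (X t) /
        laplaceMarkov l (fun i : Fin t => X i) (X t)) ≤
      (N + l : ℕ) * Real.log (Fintype.card S) / (l + 1) +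
        ∑ t ∈ Finset.range (N + l), (Fintype.card A : ℝ) /
          ((∑ b, followCount l (fun i : Fin t => X i) b : ℕ) + 1) := by
  have hcard : (0 : ℝ) < Fintype.card A := by exact_mod_cast Fintype.card_pos
  have hsplit : ∀ t ∈ Finset.range (N + l),
      Real.log (M.nextProb (fun i : Fin t => X i) (X t) /
        laplaceMarkov l (fun i : Fin t => X i) (X t)) =
      Real.log (M.nextProb (fun i : Fin t => X i) (X t)) +
        Real.log ((occ (window X l) (t - l) (window X l (t - l)) + Fintype.card A) /
          (occ (fun s => (window X l s, X (s + l))) (t - l) (window X l (t - l), X t) + 1)) := by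
    intro t ht
    have ht := Finset.mem_range.1 ht
    have h1 := hL.trans_le (M.obsProb_prefix_antitone X ht.le)
    have h2 := hL.trans_le (M.obsProb_prefix_antitone X (Nat.succ_le_of_lt ht))
    rw [laplaceMarkov, sum_followCount_prefix, followCount_prefix, ← Real.log_mul]
    · rw [div_div_eq_mul_div, mul_div_assoc]
    · rw [nextProb, ← prefix_succ]
      exact (div_pos h2 h1).ne'
    · positivity
  rw [Finset.sum_congr rfl hsplit, Finset.sum_add_distrib, M.sum_log_nextProb X hL]
  simp only [sum_followCount_prefix]
  have hmain := M.sum_log_laplace_le X l N hL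
  rw [add_comm N l] at hmain ⊢
  rw [Finset.sum_range_add _ l N, Finset.sum_range_add _ l N]
  simp only [add_comm l _, add_tsub_cancel_right] at hmain ⊢
  -- For `t < l` truncated subtraction makes all counts zero: the estimator is uniform, and its loss
  -- `log (card A)` is at most the term `card A` charged there.
  have hhead : ∑ t ∈ Finset.range l,
      Real.log ((occ (window X l) (t - l) (window X l (t - l)) + Fintype.card A) /
        (occ (fun s => (window X l s, X (s + l))) (t - l) (window X l (t - l), X t) + 1)) ≤
      ∑ t ∈ Finset.range l,
        (Fintype.card A : ℝ) / (occ (window X l) (t - l) (window X l (t - l)) + 1) := by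
    refine Finset.sum_le_sum fun t ht => ?_
    rw [Nat.sub_eq_zero_of_le (Finset.mem_range.1 ht).le]
    simpa [occ] using Real.log_le_self hcard.le
  linarith

/-! ### From log loss to expected `ℓ₁` error -/

/-- A linearised Pinsker-type inequality, for one pair of weights. -/
theorem abs_sub_le_mul_log_div {p q η : ℝ} (hp : 0 ≤ p) (hq : 0 < q) (hη : 0 < η) :
    |p - q| ≤ 1 / η * (p * Real.log (p / q) - p + q) + η / 2 * (p + q) := by
  -- Square roots pass through the Hellinger distance: `(a - b) ^ 2` is at most the entropy term,
  -- and `|a - b| * (a + b)` splits by the arithmetic-geometric mean inequality.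
  obtain ⟨a, ha, rfl⟩ : ∃ a, 0 ≤ a ∧ p = a ^ 2 := ⟨√p, Real.sqrt_nonneg p, (Real.sq_sqrt hp).symm⟩
  obtain ⟨b, hb, rfl⟩ : ∃ b, 0 < b ∧ q = b ^ 2 :=
    ⟨√q, Real.sqrt_pos.2 hq, (Real.sq_sqrt hq.le).symm⟩
  have h1 : (a - b) ^ 2 ≤ a ^ 2 * Real.log (a ^ 2 / b ^ 2) - a ^ 2 + b ^ 2 := by
    rcases ha.eq_or_lt with rfl | ha
    · simp
    · have := Real.log_le_sub_one_of_pos (div_pos hb ha)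
      rw [Real.log_div hb.ne' ha.ne'] at this
      have h2 : a ^ 2 * (Real.log b - Real.log a) ≤ a ^ 2 * (b / a - 1) := by gcongr
      have h3 : a ^ 2 * (b / a - 1) = a * b - a ^ 2 := by field_simp
      rw [Real.log_div (by positivity) (by positivity), Real.log_pow, Real.log_pow]
      push_cast
      linarith
  have h2 : |a ^ 2 - b ^ 2| = |a - b| * (a + b) := by
    rw [show a ^ 2 - b ^ 2 = (a - b) * (a + b) by ring, abs_mul,
      abs_of_nonneg (by positivity : 0 ≤ a + b)]
  have h3 : |a - b| * (a + b) ≤ 1 / η * (a - b) ^ 2 + η / 2 * (a ^ 2 + b ^ 2) := by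
    rw [← sq_abs (a - b)]
    have h4 : 0 ≤ 1 / η * (|a - b| - η / 2 * (a + b)) ^ 2 := by positivity
    have h5 : 1 / η * (|a - b| - η / 2 * (a + b)) ^ 2 =
        1 / η * |a - b| ^ 2 - |a - b| * (a + b) + η / 4 * (a + b) ^ 2 := by
      field_simp
      ring
    nlinarith [mul_nonneg hη.le (sq_nonneg (a - b))]
  rw [h2]
  exact h3.trans (by gcongr)

theorem sum_abs_sub_le_sum_mul_log_div {A : Type*} [Fintype A] {p q : A → ℝ} {η : ℝ}
    (hp : p ∈ stdSimplex ℝ A) (hq : ∀ a, 0 < q a) (hq1 : ∑ a, q a = 1) (hη : 0 < η) :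
    ∑ a, |p a - q a| ≤ 1 / η * ∑ a, p a * Real.log (p a / q a) + η := by
  refine (Finset.sum_le_sum fun a _ =>
    abs_sub_le_mul_log_div (hp.1 a) (hq a) hη).trans (le_of_eq ?_)
  rw [Finset.sum_add_distrib, ← Finset.mul_sum, ← Finset.mul_sum, Finset.sum_add_distrib,
    Finset.sum_sub_distrib, Finset.sum_add_distrib, hp.2, hq1]
  ring

theorem sum_abs_sub_le_two {A : Type*} [Fintype A] {p q : A → ℝ}
    (hp : p ∈ stdSimplex ℝ A) (hq : q ∈ stdSimplex ℝ A) : ∑ a, |p a - q a| ≤ 2 := by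
  calc ∑ a, |p a - q a| ≤ ∑ a, (p a + q a) := Finset.sum_le_sum fun a _ => by
        have := hp.1 a
        have := hq.1 a
        exact abs_le.2 ⟨by linarith, by linarith⟩
    _ = 2 := by rw [Finset.sum_add_distrib, hp.2, hq.2]; norm_num

section Markov

variable {A : Type*} [Fintype A] [DecidableEq A] (l : ℕ) {t : ℕ} (x : Fin t → A)

theorem laplaceMarkov_pos [Nonempty A] (a : A) : 0 < laplaceMarkov l x a := by
  have : (0 : ℝ) < Fintype.card A := by exact_mod_cast Fintype.card_pos
  unfold laplaceMarkov
  positivity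

theorem sum_laplaceMarkov [Nonempty A] : ∑ a, laplaceMarkov l x a = 1 := by
  have : (0 : ℝ) < Fintype.card A := by exact_mod_cast Fintype.card_pos
  simp only [laplaceMarkov]
  rw [← Finset.sum_div, Finset.sum_add_distrib, ← Nat.cast_sum]
  simp only [Finset.sum_const, Finset.card_univ, nsmul_eq_mul, mul_one]
  exact div_self (by positivity)

theorem empiricalMarkov_mem {fallback : A → ℝ} (h : fallback ∈ stdSimplex ℝ A) :
    empiricalMarkov l fallback x ∈ stdSimplex ℝ A := by
  by_cases hN : ∑ b, followCount l x b = 0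
  · have : empiricalMarkov l fallback x = fallback := by
      funext a; simp only [empiricalMarkov, if_pos hN]
    rwa [this]
  · refine ⟨fun a => ?_, ?_⟩
    · simp only [empiricalMarkov, if_neg hN]
      positivity
    · simp only [empiricalMarkov, if_neg hN]
      rw [← Finset.sum_div, ← Nat.cast_sum, div_self (by exact_mod_cast hN)]

theorem sum_abs_laplaceMarkov_sub_empiricalMarkov_le [Nonempty A] {fallback : A → ℝ}
    (h : fallback ∈ stdSimplex ℝ A) :
    ∑ a, |laplaceMarkov l x a - empiricalMarkov l fallback x a| ≤
      2 * ((Fintype.card A : ℝ) / ((∑ b, followCount l x b : ℕ) + 1)) := by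
  have hd : (1 : ℝ) ≤ Fintype.card A := by exact_mod_cast Fintype.card_pos
  by_cases hN : ∑ b, followCount l x b = 0
  · refine (sum_abs_sub_le_two ⟨fun a => (laplaceMarkov_pos l x a).le, sum_laplaceMarkov l x⟩
      (empiricalMarkov_mem l x h)).trans ?_
    rw [hN, Nat.cast_zero, zero_add, div_one]
    linarith
  · simp only [empiricalMarkov, if_neg hN, laplaceMarkov]
    have hsum : ∑ a, (followCount l x a : ℝ) = (∑ b, followCount l x b : ℕ) := by push_cast; rfl
    set N : ℕ := ∑ b, followCount l x b
    have hN' : (0 : ℝ) < N := by exact_mod_cast Nat.pos_of_ne_zero hN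
    set d : ℝ := (Fintype.card A : ℝ) with hdd
    calc ∑ a, |((followCount l x a : ℝ) + 1) / (N + d) - followCount l x a / N|
        ≤ ∑ a, (N + d * followCount l x a) / (N * (N + d)) := by
          refine Finset.sum_le_sum fun a _ => ?_
          have e : ((followCount l x a : ℝ) + 1) / (N + d) - followCount l x a / N =
              (N - d * followCount l x a) / (N * (N + d)) := by
            field_simp; ring
          rw [e, abs_div, abs_of_pos (by positivity : (0 : ℝ) < N * (N + d))]
          gcongr
          have : (0 : ℝ) ≤ d * followCount l x a := by positivity
          exact abs_le.2 ⟨by linarith, by linarith⟩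
      _ = 2 * (d / (N + d)) := by
          rw [← Finset.sum_div, Finset.sum_add_distrib, ← Finset.mul_sum, hsum]
          simp only [Finset.sum_const, Finset.card_univ, nsmul_eq_mul, ← hdd]
          field_simp; ring
      _ ≤ 2 * (d / (N + 1)) := by gcongr

end Markov

namespace HMM

variable {S A : Type*} [Fintype S] [Fintype A] (M : HMM S A)

theorem expectedL1_nonneg (t : ℕ) (q : (Fin t → A) → A → ℝ) : 0 ≤ M.expectedL1 t q :=
  Finset.sum_nonneg fun x _ =>
    mul_nonneg (M.obsProb_nonneg x) (Finset.sum_nonneg fun _ _ => abs_nonneg _)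

theorem expectedL1_le_of_forall (t : ℕ) (q : (Fin t → A) → A → ℝ) (b : ℝ)
    (h : ∀ x : Fin t → A, 0 < M.obsProb x → ∑ a, |M.nextProb x a - q x a| ≤ b) :
    M.expectedL1 t q ≤ b := by
  calc M.expectedL1 t q ≤ ∑ x : Fin t → A, M.obsProb x * b := by
        refine Finset.sum_le_sum fun x _ => ?_
        rcases (M.obsProb_nonneg x).eq_or_lt with h0 | h0
        · simp [← h0]
        · exact mul_le_mul_of_nonneg_left (h x h0) h0.le
    _ = b := by rw [← Finset.sum_mul, sum_obsProb, one_mul]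

/-- Bound on the cumulative expected `ℓ₁` error of the empirical `l`-th order Markov model. -/
theorem sum_expectedL1_empiricalMarkov_le [DecidableEq A] [Nonempty A] (l N : ℕ)
    (fallback : (t : ℕ) → (Fin t → A) → A → ℝ)
    (hf : ∀ t x, fallback t x ∈ stdSimplex ℝ A) {η : ℝ} (hη : 0 < η) :
    ∑ t ∈ Finset.range (N + l),
        M.expectedL1 t (fun x => empiricalMarkov l (fallback t x) x) ≤
      1 / η * ((N + l : ℕ) * Real.log (Fintype.card S) / (l + 1)) +
        (1 / η + 2) *
          (Fintype.card A * (l + Fintype.card A ^ l * (1 + Real.log N))) + η * (N + l : ℕ) := by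
  let D : (t : ℕ) → (Fin t → A) → ℝ := fun t x =>
    (Fintype.card A : ℝ) / ((∑ b, followCount l x b : ℕ) + 1)
  -- A cost per observed letter whose conditional mean dominates the `ℓ₁` error; its sum along a
  -- path is then bounded pathwise.
  let g : (t : ℕ) → (Fin t → A) → A → ℝ := fun t x a =>
    1 / η * Real.log (M.nextProb x a / laplaceMarkov l x a) + 2 * D t x + η
  have hstep : ∀ t, M.expectedL1 t (fun x => empiricalMarkov l (fallback t x) x) ≤
      ∑ x : Fin t → A, M.obsProb x * ∑ a, M.nextProb x a * g t x a := by
    intro t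
    refine Finset.sum_le_sum fun x _ => ?_
    rcases (M.obsProb_nonneg x).eq_or_lt with h0 | h0
    · simp [← h0]
    refine mul_le_mul_of_nonneg_left ?_ h0.le
    have hp := M.nextProb_mem x h0
    have h1 := sum_abs_sub_le_sum_mul_log_div hp (laplaceMarkov_pos l x)
      (sum_laplaceMarkov l x) hη
    have h2 := sum_abs_laplaceMarkov_sub_empiricalMarkov_le l x (hf t x)
    have h3 : ∑ a, M.nextProb x a * g t x a =
        1 / η * ∑ a, M.nextProb x a * Real.log (M.nextProb x a / laplaceMarkov l x a) +
          2 * D t x + η := by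
      simp only [g, mul_add, Finset.sum_add_distrib, ← Finset.sum_mul, hp.2, Finset.mul_sum,
        one_mul]
      congr 2
      exact Finset.sum_congr rfl fun a _ => by ring
    rw [h3]
    calc ∑ a, |M.nextProb x a - empiricalMarkov l (fallback t x) x a|
        ≤ ∑ a, (|M.nextProb x a - laplaceMarkov l x a| +
            |laplaceMarkov l x a - empiricalMarkov l (fallback t x) x a|) :=
          Finset.sum_le_sum fun a _ => abs_sub_le _ _ _
      _ ≤ _ := by rw [Finset.sum_add_distrib]; simp only [D]; linarith
  refine (Finset.sum_le_sum fun t _ => hstep t).trans ?_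
  rw [M.sum_obsProb_mul_sum_nextProb g]
  set B := 1 / η * ((N + l : ℕ) * Real.log (Fintype.card S) / (l + 1)) +
        (1 / η + 2) *
          (Fintype.card A * (l + Fintype.card A ^ l * (1 + Real.log N))) + η * (N + l : ℕ)
  have hpath : ∀ x : Fin (N + l) → A, M.obsProb x * ∑ t : Fin (N + l),
      g t (fun i : Fin t => x ⟨i, i.isLt.trans t.isLt⟩) (x t) ≤ M.obsProb x * B := by
    intro x
    rcases (M.obsProb_nonneg x).eq_or_lt with h0 | h0
    · simp [← h0]
    refine mul_le_mul_of_nonneg_left ?_ h0.le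
    obtain ⟨X, rfl⟩ : ∃ X : ℕ → A, x = fun i : Fin (N + l) => X i :=
      ⟨fun i => if h : i < N + l then x ⟨i, h⟩ else Classical.arbitrary A, by
        funext i; simp⟩
    rw [Fin.sum_univ_eq_sum_range (fun t => g t (fun i : Fin t => X i) (X t))]
    simp only [g, Finset.sum_add_distrib, ← Finset.mul_sum, Finset.sum_const, Finset.card_range,
      nsmul_eq_mul]
    have h1 := M.sum_log_nextProb_div_laplaceMarkov_le X l N h0
    have h2 := sum_inv_context_count_le X l N
    have h3 : (0 : ℝ) < 1 / η := by positivity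
    have h4 := mul_le_mul_of_nonneg_left (h1.trans (add_le_add_right h2 _)) h3.le
    simp only [B, D]
    linarith
  refine (Finset.sum_le_sum fun x _ => hpath x).trans (le_of_eq ?_)
  rw [← Finset.sum_mul, sum_obsProb, one_mul]

end HMM

/-! ### Choice of the constants -/

/-- The cost of learning `d ^ (l + 1)` frequencies is negligible after `d ^ (6 * l)` steps. -/
theorem learning_cost_le {d l T N : ℕ} (hd : 2 ≤ d) (hl : 1 ≤ l) (hT : d ^ (6 * l) ≤ T)
    (hN : N + l = T + 1) :
    (d : ℝ) * (l + d ^ l * (1 + Real.log N)) ≤ 4 * T / (l + 1) := by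
  have hd' : (2 : ℝ) ≤ d := by exact_mod_cast hd
  have hdl1 : (l : ℝ) + 1 ≤ d ^ l := by
    have : l + 1 ≤ d ^ l := Nat.lt_pow_self (by omega)
    exact_mod_cast this
  have hdd : (d : ℝ) ≤ d ^ l := le_self_pow₀ (by linarith) (by omega)
  set y := √(T : ℝ) with hy
  have hyT : y ^ 2 = T := Real.sq_sqrt (Nat.cast_nonneg _)
  have hTR : ((d : ℝ) ^ (3 * l)) ^ 2 ≤ T := by
    rw [← pow_mul, show 3 * l * 2 = 6 * l by ring]
    exact_mod_cast hT
  have hy3 : (d : ℝ) ^ (3 * l) ≤ y := Real.le_sqrt_of_sq_le hTR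
  have hl0 : (0 : ℝ) ≤ l := Nat.cast_nonneg _
  have hE1 : (1 : ℝ) ≤ d ^ l := by linarith
  have hcube : (d : ℝ) ^ (3 * l) = d ^ l * (d ^ l * d ^ l) := by ring
  set E := (d : ℝ) ^ l
  have hEE : 1 ≤ E * E := by nlinarith
  have hy1 : 1 ≤ y := by nlinarith
  have hN1 : Real.log N ≤ 2 * y := by
    rcases Nat.eq_zero_or_pos N with rfl | hN0
    · simp; linarith
    have hNpos : (0 : ℝ) < N := by exact_mod_cast hN0
    have hNT : (N : ℝ) ≤ (y + 1) ^ 2 := by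
      have : (N : ℝ) ≤ T + 1 := by exact_mod_cast (by omega : N ≤ T + 1)
      nlinarith
    have h1 := Real.log_le_log hNpos hNT
    rw [Real.log_pow] at h1
    have h2 := Real.log_le_sub_one_of_pos (show 0 < y + 1 by linarith)
    push_cast at h1
    linarith
  -- With `E = d ^ l` and `y = √T`, the cost is at most `4 * E ^ 2 * y`. The exponent `6` gives `E ^
  -- 3 ≤ y`, so `E ^ 2 * (l + 1) ≤ y` because `l + 1 ≤ E`.
  have hD : (d : ℝ) * (l + E * (1 + Real.log N)) ≤ E * (E * (4 * y)) := by
    have h1 : l + E * (1 + Real.log N) ≤ E * (4 * y) := by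
      have : E * Real.log N ≤ E * (2 * y) := by gcongr
      nlinarith
    have h2 : 0 ≤ E * (4 * y) := by positivity
    nlinarith [mul_le_mul_of_nonneg_right hdd h2,
      mul_le_mul_of_nonneg_left h1 (by linarith : (0 : ℝ) ≤ d)]
  refine hD.trans ?_
  rw [le_div_iff₀ (by positivity), ← hyT]
  have h3 : E * (E * E) ≤ y := by rw [← hcube]; exact hy3
  have h4 : E * E * (l + 1) ≤ y := by
    refine le_trans ?_ h3
    nlinarith
  nlinarith

theorem theorem1 :
    ∃ (C : ℝ) (c : ℕ), ∀ (n : ℕ) (ε : ℝ), 2 ≤ n → 1 / (Real.log n) ^ (0.25 : ℝ) < ε →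
      ∃ l : ℕ, (l : ℝ) ≤ C * (Real.log n / ε) ∧
        ∀ (k d : ℕ), k ≤ n → ∀ (M : HMM (Fin k) (Fin d))
          (fallback : (t : ℕ) → (Fin t → Fin d) → Fin d → ℝ),
          (∀ t x, fallback t x ∈ stdSimplex ℝ (Fin d)) →
          ∀ T : ℕ, d ^ (c * l) ≤ T →
            (1 / (T : ℝ)) * ∑ t ∈ Finset.Icc 1 T,
                M.expectedL1 t (fun x => empiricalMarkov l (fallback t x) x) ≤ √ε := by
  refine ⟨200, 6, fun n ε hn hε => ?_⟩
  have hlog2 : (0.69 : ℝ) ≤ Real.log n :=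
    (by linarith [Real.log_two_gt_d9] : (0.69 : ℝ) ≤ Real.log 2).trans
      (Real.log_le_log (by norm_num) (by exact_mod_cast hn))
  have hε0 : 0 < ε := lt_trans (by positivity) hε
  set r := Real.log n / ε with hr
  have hr0 : 0 < r := div_pos (by linarith) hε0
  refine ⟨⌊200 * r⌋₊, Nat.floor_le (by positivity), ?_⟩
  have hfloor := Nat.lt_floor_add_one (200 * r)
  set l := ⌊200 * r⌋₊ with hl
  intro k d hk M fallback hf T hT
  obtain ⟨s₀⟩ : Nonempty (Fin k) := by
    by_contra h
    rw [not_nonempty_iff] at h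
    simpa using M.init_mem.2
  obtain ⟨a₀⟩ : Nonempty (Fin d) := by
    by_contra h
    rw [not_nonempty_iff] at h
    simpa using (M.emit_mem s₀).2
  have : Nonempty (Fin d) := ⟨a₀⟩
  have hd0 : 0 < d := a₀.pos
  have hT1 : 1 ≤ T := (Nat.one_le_pow _ _ hd0).trans hT
  have hTpos : (0 : ℝ) < T := by exact_mod_cast hT1
  have hunif : ∀ b : ℝ, (∀ t, M.expectedL1 t (fun x => empiricalMarkov l (fallback t x) x) ≤ b) →
      (1 / (T : ℝ)) * ∑ t ∈ Finset.Icc 1 T,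
        M.expectedL1 t (fun x => empiricalMarkov l (fallback t x) x) ≤ b := by
    intro b hb
    rw [one_div_mul_eq_div, div_le_iff₀ hTpos]
    refine (Finset.sum_le_card_nsmul _ _ b fun t _ => hb t).trans (le_of_eq ?_)
    simp [mul_comm]
  -- For `ε ≥ 4` the trivial `ℓ₁` bound `2` suffices; otherwise `200 * r` is large enough to make `l
  -- ≥ 1`.
  rcases le_or_gt 4 ε with h4 | h4
  · refine hunif _ fun t => (M.expectedL1_le_of_forall t _ 2 fun x hx =>
      sum_abs_sub_le_two (M.nextProb_mem x hx) (empiricalMarkov_mem l x (hf t x))).trans ?_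
    exact Real.le_sqrt_of_sq_le (by linarith)
  -- A one-letter alphabet is separate, since `1 ^ (6 * l)` does not force `T` to be large; there is
  -- then only one distribution.
  rcases Nat.lt_or_ge 1 d with hd | hd
  swap
  · obtain rfl : d = 1 := by omega
    refine hunif _ fun t => (M.expectedL1_le_of_forall t _ 0 fun x hx => le_of_eq ?_).trans
      (Real.sqrt_nonneg _)
    have h1 := (M.nextProb_mem x hx).2
    have h2 := (empiricalMarkov_mem l x (hf t x)).2
    simp only [Finset.univ_unique, Finset.sum_singleton] at h1 h2 ⊢
    rw [h1, h2, sub_self, abs_zero]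
  have hrε : r * ε = Real.log n := div_mul_cancel₀ _ hε0.ne'
  have hr1 : 0.69 ≤ r * 4 := by nlinarith
  have hl1 : 1 ≤ l := Nat.le_floor (by push_cast; linarith)
  have hlT : l ≤ T := (Nat.lt_pow_self hd).le.trans
    ((Nat.pow_le_pow_right hd0 (by omega)).trans hT)
  obtain ⟨N, hN⟩ : ∃ N, N + l = T + 1 := ⟨T + 1 - l, by omega⟩
  set σ := √ε with hσ
  have hσ0 : 0 < σ := Real.sqrt_pos.2 hε0
  have hσε : σ ^ 2 = ε := Real.sq_sqrt hε0.le
  have hσ2 : σ < 2 := by nlinarith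
  -- With `η = σ / 4` and `T + 1 ≤ 2 * T`, the smoothing term costs at most `σ * T / 2`; the entropy
  -- and learning terms fit in the other half.
  have hmain := M.sum_expectedL1_empiricalMarkov_le l N fallback hf (η := σ / 4) (by positivity)
  have hcost := learning_cost_le hd hl1 hT hN
  rw [hN] at hmain
  simp only [Fintype.card_fin] at hmain
  set D : ℝ := (d : ℝ) * (l + d ^ l * (1 + Real.log N))
  have hsub : ∑ t ∈ Finset.Icc 1 T,
      M.expectedL1 t (fun x => empiricalMarkov l (fallback t x) x) ≤
      ∑ t ∈ Finset.range (T + 1),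
        M.expectedL1 t (fun x => empiricalMarkov l (fallback t x) x) :=
    Finset.sum_le_sum_of_subset_of_nonneg
      (fun t ht => by simp only [Finset.mem_Icc, Finset.mem_range] at ht ⊢; omega)
      fun t _ _ => M.expectedL1_nonneg t _
  have hk0 : 0 < k := s₀.pos
  have hlogk : Real.log k ≤ Real.log n :=
    Real.log_le_log (by exact_mod_cast hk0) (by exact_mod_cast hk)
  have hlpos : (0 : ℝ) < l + 1 := by positivity
  have hTT : ((T + 1 : ℕ) : ℝ) ≤ 2 * T := by exact_mod_cast (by omega : T + 1 ≤ 2 * T)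
  -- Here `138 = 200 * 0.69`, from `l + 1 > 200 * r` and `log n ≥ 0.69`.
  have hinv : 1 / ((l : ℝ) + 1) ≤ ε / 138 := by
    rw [div_le_div_iff₀ hlpos (by norm_num)]
    nlinarith
  have hKL : ((T + 1 : ℕ) : ℝ) * Real.log k / (l + 1) ≤ T * ε / 100 := by
    rw [div_le_div_iff₀ hlpos (by norm_num)]
    have h1 : ((T + 1 : ℕ) : ℝ) * Real.log k ≤ 2 * T * Real.log n := by
      gcongr
    have h2 : 200 * Real.log n ≤ ε * (l + 1) := by
      rw [← hrε]; nlinarith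
    nlinarith
  have hD : D ≤ T * ε / 30 := by
    refine hcost.trans ?_
    rw [show 4 * (T : ℝ) / (l + 1) = 4 * T * (1 / (l + 1)) by ring]
    nlinarith
  rw [one_div_mul_eq_div, div_le_iff₀ hTpos]
  refine (hsub.trans hmain).trans ?_
  have hinvσ : 1 / (σ / 4) * (T * ε) = 4 * σ * T := by
    rw [← hσε]; field_simp
  have hη : (0 : ℝ) < 1 / (σ / 4) := by positivity
  have e1 := mul_le_mul_of_nonneg_left hKL hη.le
  have e2 := mul_le_mul_of_nonneg_left hD hη.le
  have e3 : T * ε ≤ 2 * σ * T := by rw [← hσε]; nlinarith [mul_pos hσ0 hTpos]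
  have e4 : σ / 4 * ((T + 1 : ℕ) : ℝ) ≤ σ / 4 * (2 * T) := by gcongr
  have e5 : 0 < σ * T := by positivity
  rw [add_mul]
  linarith
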